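/- Let $R=\mathbb C[x,y,z]$. Let $\mathcal A$ be an arrangement of finitely many pairwise distinct lines in $\mathbb P^2_{\mathbb C}$ that is essential (the lines have no common point), with defining polynomial $Q=\prod_i L_i$, where the $L_i=a_ix+b_iy+c_iz$ are linear forms defining the lines. Suppose that $\mathcal A$ is free, i.e. that the $R$-module $D(\mathcal A)=\{\theta\in \mathrm{Der}_{\mathbb C}(R) : \theta(Q)\in\langle Q\rangle\}$ is free. Let $d\ge 2$ and suppose that $\mathcal A$ has a regular special logarithmic derivation of degree $d$, i.e. a derivation $\theta=A\,\partial_x+B\,\partial_y+C\,\partial_z$ with $A,B,C\in R$ homogeneous of degree $d$ and forming an $R$-regular sequence, such that $AQ_x+BQ_y+CQ_z=0$. Let $J_Q=\langle Q_x,Q_y,Q_z\rangle$ be the Jacobian ideal of $Q$. Then the degree of the reduced Jacobian scheme, i.e. of the closed subscheme of $\mathbb P^2$ defined by the radical $\sqrt{J_Q}$ (computed from the Hilbert polynomial of $R/\sqrt{J_Q}$), satisfies $$\deg\bigl(\sqrt{J_Q}\bigr)\le d^2+d+1 .$$ -/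

import Mathlib

open MvPolynomial Filter

/-- The homogeneous coordinate ring `ℂ[x, y, z]` of the complex projective plane. -/
abbrev PlaneRing : Type := MvPolynomial (Fin 3) ℂ

/-- A line arrangement in the complex projective plane, i.e. a central essential arrangement of
finitely many planes in `ℂ³`: `n` pairwise distinct lines, the `i`-th one being
`a x + b y + c z = 0` with `(a, b, c) = coeff i`, which have no common point. -/
structure LineArrangement where
  n : ℕ
  coeff : Fin n → Fin 3 → ℂ
  coeff_ne_zero : ∀ i, coeff i ≠ 0
  distinct : ∀ i j, i ≠ j → LinearIndependent ℂ ![coeff i, coeff j]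
  essential : Submodule.span ℂ (Set.range coeff) = ⊤

namespace LineArrangement

/-- The linear form `a x + b y + c z` defining the `i`-th line. -/
noncomputable def form (𝒜 : LineArrangement) (i : Fin 𝒜.n) : PlaneRing :=
  ∑ j, C (𝒜.coeff i j) * X j

/-- The defining polynomial of the arrangement, the product of the linear forms of its lines. -/
noncomputable def definingPoly (𝒜 : LineArrangement) : PlaneRing :=
  ∏ i, 𝒜.form i

end LineArrangement

/-- The `R`-module `D(Y)` of logarithmic derivations along `Y = V(F)`:
the `ℂ`-linear derivations `θ` of `R = ℂ[x, y, z]` with `θ(F) ∈ ⟨F⟩`. -/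
def logDerivations (F : PlaneRing) : Submodule PlaneRing (Derivation ℂ PlaneRing PlaneRing) where
  carrier := {θ | θ F ∈ Ideal.span {F}}
  add_mem' h₁ h₂ := (Ideal.span {F}).add_mem h₁ h₂
  zero_mem' := (Ideal.span {F}).zero_mem
  smul_mem' r θ h := by
    change r * θ F ∈ Ideal.span {F}
    exact Ideal.mul_mem_left _ r h

/-- The plane curve `V(F)` is free if `D(V(F))` is a free module over `ℂ[x, y, z]`. -/
def IsFreeCurve (F : PlaneRing) : Prop :=
  Module.Free PlaneRing (logDerivations F)

/-- `θ = A ∂/∂x + B ∂/∂y + C ∂/∂z` is a regular special logarithmic derivation of degree `d` of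
the curve `V(F)`: `A F_x + B F_y + C F_z = 0`, the coefficients `A = θ(x)`, `B = θ(y)`, `C = θ(z)`
are homogeneous of degree `d`, and they form a regular sequence. -/
structure IsRegularSpecialLogDerivation (F : PlaneRing) (d : ℕ)
    (θ : Derivation ℂ PlaneRing PlaneRing) : Prop where
  special : θ F = 0
  homogeneous : ∀ i, (θ (X i)).IsHomogeneous d
  regular : RingTheory.Sequence.IsRegular PlaneRing [θ (X 0), θ (X 1), θ (X 2)]

/-- The Jacobian ideal `⟨F_x, F_y, F_z⟩`. -/
noncomputable def jacobianIdeal (F : PlaneRing) : Ideal PlaneRing :=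
  Ideal.span (Set.range fun i => pderiv i F)

/-- The Hilbert function of `R/I`: the dimension of its degree-`t` component, that is, of the
image in `R/I` of the space of forms of degree `t`. -/
noncomputable def hilbertFunction (I : Ideal PlaneRing) (t : ℕ) : ℕ :=
  Module.finrank ℂ
    ((homogeneousSubmodule (Fin 3) ℂ t).map (Ideal.Quotient.mkₐ ℂ I).toLinearMap)

/-- `P` is the Hilbert polynomial of `R/I`. -/
def IsHilbertPolynomial (I : Ideal PlaneRing) (P : Polynomial ℚ) : Prop :=
  ∀ᶠ t : ℕ in atTop, (hilbertFunction I t : ℚ) = P.eval (t : ℚ)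

/-- The closed subscheme of the projective plane defined by the homogeneous ideal `I` has degree
`e`: the Hilbert polynomial of `R/I` exists, and `e` is its leading coefficient times the factorial
of its degree. For a zero-dimensional scheme the Hilbert polynomial is constant and equal to `e`. -/
def HasDegree (I : Ideal PlaneRing) (e : ℚ) : Prop :=
  ∃ P : Polynomial ℚ, IsHilbertPolynomial I P ∧ e = (P.natDegree.factorial : ℚ) * P.leadingCoeff

/-- The degree is unique. -/
theorem HasDegree.unique {I : Ideal PlaneRing} {e e' : ℚ}
    (h : HasDegree I e) (h' : HasDegree I e') : e = e' := by
  obtain ⟨P, hP, rfl⟩ := h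
  obtain ⟨P', hP', rfl⟩ := h'
  have key : P = P' := by
    obtain ⟨N, hN⟩ := eventually_atTop.1 (hP.and hP')
    refine Polynomial.eq_of_infinite_eval_eq P P' ?_
    refine Set.Infinite.mono ?_ ((Set.Ici_infinite N).image
      (Nat.cast_injective (R := ℚ)).injOn)
    rintro _ ⟨t, ht, rfl⟩
    exact (hN t ht).1.symm.trans (hN t ht).2
  rw [key]

/-! The coefficients of `θ` define a self-map p ↦ [A(p) : B(p) : C(p)] of the plane, without base
points because A, B, C is a regular sequence. Every singular point of the arrangement is fixed by
it: such a point p lies on two lines, and each defining form L divides θ(L), so (A(p), B(p), C(p))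
satisfies both linear equations and is a multiple of p (`exists_eval_derivation_eq_mul`).

It remains to count fixed points (`card_fixedPoints_le`). After rescaling, each one yields d - 1
nonzero solutions of A = x, B = y, C = z in ℂ³, and the origin is one more. A Bézout bound
(`card_commonZeros_le`) allows at most d³ solutions, so N(d - 1) + 1 ≤ d³, i.e. N ≤ d² + d + 1. That
bound comes from dimension counts: the Koszul relations bound below the truncations of ⟨A, B, C⟩,
and lower-order perturbations do not shrink them.

Finally, the degree of the radical is the number of singular points, by the Nullstellensatz
(`mem_radical_jacobianIdeal_iff`) and interpolation (`hasDegree_card`). -/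

/-! ### Dimensions of degree truncations of ideals -/

section FilteredDimension

/-- The polynomials all of whose monomials have degree less than `s`. -/
noncomputable def degLT (s : ℕ) : Submodule ℂ PlaneRing :=
  restrictSupport ℂ {m : Fin 3 →₀ ℕ | m.degree < s}

theorem mem_degLT_iff_coeff {s : ℕ} {f : PlaneRing} :
    f ∈ degLT s ↔ ∀ m : Fin 3 →₀ ℕ, s ≤ m.degree → coeff m f = 0 := by
  rw [degLT, mem_restrictSupport_iff]
  constructor
  · intro h m hm
    by_contra hne
    have := h (Finset.mem_coe.2 (mem_support_iff.2 hne))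
    simp only [Set.mem_ofPred_eq] at this
    omega
  · intro h m hm
    by_contra hlt
    exact (mem_support_iff.1 (Finset.mem_coe.1 hm)) (h m (by simpa using hlt))

theorem mem_degLT_iff {s : ℕ} {f : PlaneRing} :
    f ∈ degLT s ↔ ∀ i, s ≤ i → homogeneousComponent i f = 0 := by
  classical
  rw [mem_degLT_iff_coeff]
  constructor
  · intro h i hi
    ext m
    rw [coeff_homogeneousComponent, coeff_zero]
    split_ifs with hm
    · exact h m (by omega)
    · rfl
  · intro h m hm
    have := congrArg (coeff m) (h _ hm)
    simpa [coeff_homogeneousComponent] using this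

instance finiteDimensional_degLT (s : ℕ) : FiniteDimensional ℂ (degLT s) := by
  have : Finite {m : Fin 3 →₀ ℕ | m.degree < s} := by
    have : {m : Fin 3 →₀ ℕ | m.degree < s} ⊆
        ⋃ t ∈ Finset.range s, (Finset.finsuppAntidiag Finset.univ t : Finset (Fin 3 →₀ ℕ)) := by
      intro m hm
      simp only [Set.mem_ofPred_eq] at hm
      simp only [Set.mem_iUnion]
      refine ⟨m.degree, Finset.mem_range.2 hm, ?_⟩
      simp [Finset.mem_finsuppAntidiag, Finsupp.degree_eq_sum]
    exact (Set.Finite.subset (Set.Finite.biUnion (Finset.finite_toSet _)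
      fun _ _ => Finset.finite_toSet _) this)
  exact Module.Finite.of_basis (basisRestrictSupport ℂ _)

theorem homogeneousSubmodule_eq_restrictSupport (t : ℕ) :
    homogeneousSubmodule (Fin 3) ℂ t = restrictSupport ℂ {m : Fin 3 →₀ ℕ | m.degree = t} :=
  homogeneousSubmodule_eq_finsupp_supported (Fin 3) ℂ t

theorem finrank_homogeneousSubmodule (t : ℕ) :
    Module.finrank ℂ (homogeneousSubmodule (Fin 3) ℂ t) = (t + 2).choose 2 := by
  rw [homogeneousSubmodule_eq_restrictSupport,
    Module.finrank_eq_nat_card_basis (basisRestrictSupport ℂ _)]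
  have : {m : Fin 3 →₀ ℕ | m.degree = t} =
      (Finset.finsuppAntidiag Finset.univ t : Finset (Fin 3 →₀ ℕ)) := by
    ext m
    simp [Finset.mem_finsuppAntidiag, Finsupp.degree_eq_sum]
  rw [this, Nat.card_eq_card_toFinset, Finset.toFinset_coe,
    Finset.card_finsuppAntidiag_nat_eq_choose, Finset.card_univ, Fintype.card_fin,
    show 3 + t - 1 = t + 2 by omega, ← Nat.choose_symm_add]

theorem homogeneousSubmodule_le_degLT {t s : ℕ} (h : t < s) :
    homogeneousSubmodule (Fin 3) ℂ t ≤ degLT s := by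
  intro f hf
  refine mem_degLT_iff.2 fun i hi => ?_
  rw [homogeneousComponent_of_mem ((mem_homogeneousSubmodule t f).1 hf), if_neg (by omega)]

instance (t : ℕ) : FiniteDimensional ℂ (homogeneousSubmodule (Fin 3) ℂ t) :=
  Submodule.finiteDimensional_of_le (homogeneousSubmodule_le_degLT t.lt_succ_self)

theorem degLT_mono {s t : ℕ} (h : s ≤ t) : degLT s ≤ degLT t := fun _ hf =>
  mem_degLT_iff.2 fun i hi => mem_degLT_iff.1 hf i (h.trans hi)

theorem degLT_zero : degLT 0 = ⊥ := by
  rw [eq_bot_iff]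
  intro f hf
  rw [Submodule.mem_bot]
  ext m
  simpa using mem_degLT_iff_coeff.1 hf m (Nat.zero_le _)

theorem homogeneousComponent_homogeneousComponent (i j : ℕ) (f : PlaneRing) :
    homogeneousComponent i (homogeneousComponent j f) =
      if i = j then homogeneousComponent j f else 0 :=
  homogeneousComponent_of_mem (homogeneousComponent_isHomogeneous j f)

theorem degLT_succ (s : ℕ) :
    degLT (s + 1) = degLT s ⊔ homogeneousSubmodule (Fin 3) ℂ s := by
  refine le_antisymm (fun f hf => ?_)
    (sup_le (degLT_mono s.le_succ) (homogeneousSubmodule_le_degLT s.lt_succ_self))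
  rw [Submodule.mem_sup]
  refine ⟨f - homogeneousComponent s f, ?_, homogeneousComponent s f,
    homogeneousComponent_mem s f, by ring⟩
  refine mem_degLT_iff.2 fun i hi => ?_
  rw [map_sub, homogeneousComponent_homogeneousComponent]
  split_ifs with h
  · rw [h, sub_self]
  · rw [mem_degLT_iff.1 hf i (by omega), sub_zero]

theorem finrank_degLT (s : ℕ) : Module.finrank ℂ (degLT s) = (s + 2).choose 3 := by
  induction s with
  | zero => simp [degLT_zero]
  | succ s ih =>
    have hinf : degLT s ⊓ homogeneousSubmodule (Fin 3) ℂ s = ⊥ := by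
      rw [eq_bot_iff]
      rintro f ⟨h₁, h₂⟩
      have := mem_degLT_iff.1 h₁ s le_rfl
      rwa [homogeneousComponent_of_mem ((mem_homogeneousSubmodule s f).1 h₂), if_pos rfl] at this
    have := Submodule.finrank_sup_add_finrank_inf_eq (degLT s) (homogeneousSubmodule (Fin 3) ℂ s)
    rw [hinf, finrank_bot, ← degLT_succ, ih, finrank_homogeneousSubmodule] at this
    rw [show s + 1 + 2 = (s + 2) + 1 by ring, Nat.choose_succ_succ' (s + 2) 2]
    linarith

/-- The bounds are strict: degrees at most m - 1 and at most n add up to less than m + n. -/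
theorem mul_mem_degLT {m n : ℕ} {f g : PlaneRing} (hf : f ∈ degLT m) (hg : g ∈ degLT (n + 1)) :
    f * g ∈ degLT (m + n) := by
  classical
  rw [mem_degLT_iff_coeff] at *
  intro k hk
  rw [coeff_mul]
  refine Finset.sum_eq_zero fun x hx => ?_
  have hdeg : x.1.degree + x.2.degree = k.degree := by
    rw [← map_add, Finset.HasAntidiagonal.mem_antidiagonal.1 hx]
  by_cases h : m ≤ x.1.degree
  · rw [hf _ h, zero_mul]
  · rw [hg _ (by omega), mul_zero]

attribute [local instance] MvPolynomial.gradedAlgebra in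
theorem homogeneousComponent_mul_of_isHomogeneous {A : PlaneRing} {d : ℕ}
    (hA : A.IsHomogeneous d) (u : PlaneRing) (i : ℕ) :
    homogeneousComponent i (A * u) =
      if d ≤ i then A * homogeneousComponent (i - d) u else 0 := by
  have := DirectSum.coe_decompose_mul_of_left_mem (homogeneousSubmodule (Fin 3) ℂ) (b := u) i
    ((mem_homogeneousSubmodule d A).2 hA)
  have key : ∀ (j : ℕ) (v : PlaneRing),
      (DirectSum.decompose (homogeneousSubmodule (Fin 3) ℂ) v j : PlaneRing) =
        homogeneousComponent j v := fun j v => decomposition.decompose'_apply v j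
  rwa [key, key] at this

theorem homogeneousComponent_add_mul {A : PlaneRing} {d : ℕ}
    (hA : A.IsHomogeneous d) (u : PlaneRing) (i : ℕ) :
    homogeneousComponent (i + d) (A * u) = A * homogeneousComponent i u := by
  rw [homogeneousComponent_mul_of_isHomogeneous hA, if_pos (Nat.le_add_left d i),
    Nat.add_sub_cancel]

theorem mul_mem_degLT_of_isHomogeneous {A u : PlaneRing} {d s : ℕ} (hA : A.IsHomogeneous d)
    (hu : u ∈ degLT s) : A * u ∈ degLT (s + d) := by
  refine mem_degLT_iff.2 fun i hi => ?_
  rw [homogeneousComponent_mul_of_isHomogeneous hA, if_pos (by omega),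
    mem_degLT_iff.1 hu _ (by omega), mul_zero]

theorem mem_degLT_of_mul_mem {A u : PlaneRing} {d s : ℕ} (hA : A.IsHomogeneous d) (hA0 : A ≠ 0)
    (hu : A * u ∈ degLT s) : u ∈ degLT (s - d) := by
  refine mem_degLT_iff.2 fun i hi => ?_
  have := mem_degLT_iff.1 hu (i + d) (by omega)
  rw [homogeneousComponent_add_mul hA] at this
  exact (mul_eq_zero.1 this).resolve_left hA0

theorem exists_truncation (u : PlaneRing) (s : ℕ) :
    ∃ v ∈ degLT s, ∀ i < s, homogeneousComponent i v = homogeneousComponent i u := by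
  have h : ∀ i, homogeneousComponent i (∑ j ∈ Finset.range s, homogeneousComponent j u) =
      if i < s then homogeneousComponent i u else 0 := by
    intro i
    simp_rw [map_sum, homogeneousComponent_homogeneousComponent]
    rw [Finset.sum_ite_eq]
    simp only [Finset.mem_range]
  refine ⟨∑ j ∈ Finset.range s, homogeneousComponent j u,
    mem_degLT_iff.2 fun i hi => ?_, fun i hi => ?_⟩
  · rw [h, if_neg (by omega)]
  · rw [h, if_pos hi]

theorem eq_of_homogeneousComponent_eq {f g : PlaneRing}
    (h : ∀ i, homogeneousComponent i f = homogeneousComponent i g) : f = g := by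
  ext m
  have := congrArg (coeff m) (h m.degree)
  simpa [coeff_homogeneousComponent] using this

/-- Multiplication by A and B shifts degrees by exactly d, so the parts of the cofactors in degrees
≥ s - d cannot affect w and may be discarded. -/
theorem exists_degLT_of_eq_mul_add_mul {A B u v w : PlaneRing} {d s : ℕ} (hA : A.IsHomogeneous d)
    (hB : B.IsHomogeneous d) (hw : w ∈ degLT s) (h : w = A * u + B * v) :
    ∃ u' ∈ degLT (s - d), ∃ v' ∈ degLT (s - d), w = A * u' + B * v' := by
  obtain ⟨u', hu', hu⟩ := exists_truncation u (s - d)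
  obtain ⟨v', hv', hv⟩ := exists_truncation v (s - d)
  refine ⟨u', hu', v', hv', eq_of_homogeneousComponent_eq fun i => ?_⟩
  rw [map_add, homogeneousComponent_mul_of_isHomogeneous hA,
    homogeneousComponent_mul_of_isHomogeneous hB]
  by_cases hi : i < s
  · rw [h, map_add, homogeneousComponent_mul_of_isHomogeneous hA,
      homogeneousComponent_mul_of_isHomogeneous hB]
    split_ifs with hd
    · rw [hu _ (by omega), hv _ (by omega)]
    · rfl
  · rw [mem_degLT_iff.1 hw i (by omega)]
    split_ifs with hd
    · rw [mem_degLT_iff.1 hu' _ (by omega), mem_degLT_iff.1 hv' _ (by omega)]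
      simp
    · simp

/-- The image of a subspace under multiplication by a polynomial. -/
noncomputable abbrev mulMap (A : PlaneRing) (V : Submodule ℂ PlaneRing) : Submodule ℂ PlaneRing :=
  V.map (LinearMap.mulLeft ℂ A)

theorem mem_mulMap {A f : PlaneRing} {V : Submodule ℂ PlaneRing} :
    f ∈ mulMap A V ↔ ∃ u ∈ V, A * u = f := by
  simp [mulMap, Submodule.mem_map]

theorem mul_mem_mulMap {A u : PlaneRing} {V : Submodule ℂ PlaneRing} (hu : u ∈ V) :
    A * u ∈ mulMap A V := mem_mulMap.2 ⟨u, hu, rfl⟩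

theorem finrank_mulMap {A : PlaneRing} (hA : A ≠ 0) (V : Submodule ℂ PlaneRing) :
    Module.finrank ℂ (mulMap A V) = Module.finrank ℂ V :=
  (LinearEquiv.finrank_eq (Submodule.equivMapOfInjective (LinearMap.mulLeft ℂ A)
    (mul_right_injective₀ hA) V)).symm

/-- By regularity a common multiple Au = Bv is a multiple of AB, so the intersection of the two
summands is a copy of `degLT (s - d)`. -/
theorem finrank_mulMap_sup_mulMap {A B : PlaneRing} {d : ℕ} (hA : A.IsHomogeneous d)
    (hB : B.IsHomogeneous d) (hA0 : A ≠ 0) (hB0 : B ≠ 0)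
    (hreg : ∀ v, A ∣ B * v → A ∣ v) (s : ℕ) :
    Module.finrank ℂ ↥(mulMap A (degLT s) ⊔ mulMap B (degLT s)) +
      Module.finrank ℂ (degLT (s - d)) = 2 * Module.finrank ℂ (degLT s) := by
  have hinf : mulMap A (degLT s) ⊓ mulMap B (degLT s) = mulMap (A * B) (degLT (s - d)) := by
    ext f
    rw [Submodule.mem_inf, mem_mulMap, mem_mulMap, mem_mulMap]
    constructor
    · rintro ⟨⟨u, hu, rfl⟩, v, hv, hvu⟩
      obtain ⟨w, rfl⟩ := hreg v ⟨u, hvu⟩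
      exact ⟨w, mem_degLT_of_mul_mem hA hA0 hv, by rw [← hvu]; ring⟩
    · rintro ⟨w, hw, rfl⟩
      rcases le_or_gt d s with hds | hds
      · have hs : s - d + d = s := Nat.sub_add_cancel hds
        exact ⟨⟨B * w, hs ▸ mul_mem_degLT_of_isHomogeneous hB hw, by ring⟩,
          A * w, hs ▸ mul_mem_degLT_of_isHomogeneous hA hw, by ring⟩
      · rw [Nat.sub_eq_zero_of_le hds.le, degLT_zero, Submodule.mem_bot] at hw
        subst hw
        exact ⟨⟨0, zero_mem _, by simp⟩, 0, zero_mem _, by simp⟩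
  have := Submodule.finrank_sup_add_finrank_inf_eq (mulMap A (degLT s)) (mulMap B (degLT s))
  rw [hinf, finrank_mulMap hA0, finrank_mulMap hB0, finrank_mulMap (mul_ne_zero hA0 hB0)] at this
  omega

/-- The space `A V + B V + C V`. -/
noncomputable abbrev mulMap₃ (f : Fin 3 → PlaneRing) (V : Submodule ℂ PlaneRing) :
    Submodule ℂ PlaneRing :=
  mulMap (f 0) V ⊔ mulMap (f 1) V ⊔ mulMap (f 2) V

/-- Divisibility form of the condition that three polynomials form a regular sequence. -/
structure IsRegularTriple (f : Fin 3 → PlaneRing) : Prop where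
  ne_zero : ∀ i, f i ≠ 0
  second : ∀ v, f 0 ∣ f 1 * v → f 0 ∣ v
  third : ∀ w, (∃ u v, f 2 * w = f 0 * u + f 1 * v) → ∃ u v, w = f 0 * u + f 1 * v

/-- The Koszul count. An element of (AV + BV) ∩ CV is Cw with w ∈ ⟨A, B⟩ by regularity, and the
cofactors of w can be truncated. Bounding this intersection above bounds the sum below. -/
theorem finrank_mulMap₃_ge {f : Fin 3 → PlaneRing} {d : ℕ} (hf : ∀ i, (f i).IsHomogeneous d)
    (hreg : IsRegularTriple f) (s : ℕ) :
    3 * Module.finrank ℂ (degLT s) + Module.finrank ℂ (degLT (s - d - d)) ≤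
      Module.finrank ℂ (mulMap₃ f (degLT s)) + 3 * Module.finrank ℂ (degLT (s - d)) := by
  have hinf : (mulMap (f 0) (degLT s) ⊔ mulMap (f 1) (degLT s)) ⊓ mulMap (f 2) (degLT s) ≤
      mulMap (f 2) (mulMap (f 0) (degLT (s - d)) ⊔ mulMap (f 1) (degLT (s - d))) := by
    rintro g ⟨h₁, h₂⟩
    obtain ⟨w, hw, rfl⟩ := mem_mulMap.1 h₂
    obtain ⟨_, ha, _, hb, hab⟩ := Submodule.mem_sup.1 h₁
    obtain ⟨u, -, rfl⟩ := mem_mulMap.1 ha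
    obtain ⟨v, -, rfl⟩ := mem_mulMap.1 hb
    obtain ⟨u', v', huv⟩ := hreg.third w ⟨u, v, hab.symm⟩
    obtain ⟨u'', hu'', v'', hv'', rfl⟩ := exists_degLT_of_eq_mul_add_mul (hf 0) (hf 1) hw huv
    exact mul_mem_mulMap (Submodule.add_mem_sup (mul_mem_mulMap hu'') (mul_mem_mulMap hv''))
  have h₁ := Submodule.finrank_sup_add_finrank_inf_eq
    (mulMap (f 0) (degLT s) ⊔ mulMap (f 1) (degLT s)) (mulMap (f 2) (degLT s))
  have h₂ := Submodule.finrank_mono hinf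
  rw [finrank_mulMap (hreg.ne_zero 2)] at h₁ h₂
  have h₃ := finrank_mulMap_sup_mulMap (hf 0) (hf 1) (hreg.ne_zero 0) (hreg.ne_zero 1)
    hreg.second s
  have h₄ := finrank_mulMap_sup_mulMap (hf 0) (hf 1) (hreg.ne_zero 0) (hreg.ne_zero 1)
    hreg.second (s - d)
  unfold mulMap₃
  omega

theorem mulMap₃_sup (f : Fin 3 → PlaneRing) (V W : Submodule ℂ PlaneRing) :
    mulMap₃ f (V ⊔ W) = mulMap₃ f V ⊔ mulMap₃ f W := by
  simp only [mulMap₃, mulMap, Submodule.map_sup]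
  ac_rfl

theorem mulMap₃_mono (f : Fin 3 → PlaneRing) {V W : Submodule ℂ PlaneRing} (h : V ≤ W) :
    mulMap₃ f V ≤ mulMap₃ f W :=
  sup_le_sup (sup_le_sup (Submodule.map_mono h) (Submodule.map_mono h)) (Submodule.map_mono h)

theorem mulMap_add_le_degLT {A a : PlaneRing} {d : ℕ} (hA : A.IsHomogeneous d)
    (ha : a ∈ degLT d) (s : ℕ) : mulMap (A + a) (degLT s) ≤ degLT (s + d) := by
  intro g hg
  obtain ⟨u, hu, rfl⟩ := mem_mulMap.1 hg
  rw [add_mul]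
  refine add_mem (mul_mem_degLT_of_isHomogeneous hA hu) ?_
  rw [add_comm s d]
  exact mul_mem_degLT ha (degLT_mono s.le_succ hu)

theorem mulMap₃_add_le_degLT {f a : Fin 3 → PlaneRing} {d : ℕ} (hf : ∀ i, (f i).IsHomogeneous d)
    (ha : ∀ i, a i ∈ degLT d) (s : ℕ) : mulMap₃ (f + a) (degLT s) ≤ degLT (s + d) :=
  sup_le (sup_le (mulMap_add_le_degLT (hf 0) (ha 0) s) (mulMap_add_le_degLT (hf 1) (ha 1) s))
    (mulMap_add_le_degLT (hf 2) (ha 2) s)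

theorem mulMap_homogeneous_le_map {A a : PlaneRing} {d : ℕ} (hA : A.IsHomogeneous d)
    (ha : a ∈ degLT d) (s : ℕ) :
    mulMap A (homogeneousSubmodule (Fin 3) ℂ s) ≤
      (mulMap (A + a) (degLT (s + 1))).map (homogeneousComponent (s + d)) := by
  intro g hg
  obtain ⟨u, hu, rfl⟩ := mem_mulMap.1 hg
  have hu' := homogeneousSubmodule_le_degLT s.lt_succ_self hu
  refine ⟨(A + a) * u, mul_mem_mulMap hu', ?_⟩
  have h0 := mem_degLT_iff.1 (mul_mem_degLT ha hu') (s + d) (by omega)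
  rw [add_mul, map_add, h0, homogeneousComponent_add_mul hA, add_zero,
    homogeneousComponent_of_mem ((mem_homogeneousSubmodule s u).1 hu), if_pos rfl]

/-- Perturbing homogeneous forms by terms of lower degree does not decrease the dimension of
the truncations of the ideal they generate. -/
theorem finrank_mulMap₃_le_finrank_mulMap₃_add {f a : Fin 3 → PlaneRing} {d : ℕ}
    (hf : ∀ i, (f i).IsHomogeneous d) (ha : ∀ i, a i ∈ degLT d) (s : ℕ) :
    Module.finrank ℂ (mulMap₃ f (degLT s)) ≤ Module.finrank ℂ (mulMap₃ (f + a) (degLT s)) := by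
  induction s with
  | zero =>
    have : mulMap₃ f (degLT 0) = ⊥ := by simp only [degLT_zero, mulMap₃, mulMap, Submodule.map_bot, sup_bot_eq]
    rw [this, finrank_bot]
    exact Nat.zero_le _
  | succ s ih =>
    have h₁ : Module.finrank ℂ (mulMap₃ f (degLT (s + 1))) ≤
        Module.finrank ℂ (mulMap₃ f (degLT s)) +
          Module.finrank ℂ (mulMap₃ f (homogeneousSubmodule (Fin 3) ℂ s)) := by
      rw [degLT_succ, mulMap₃_sup]
      exact Submodule.finrank_add_le_finrank_add_finrank _ _
    set K := mulMap₃ (f + a) (degLT (s + 1)) with hK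
    -- Rank-nullity for the top component on `K`: the image contains the degree s + d part generated
    -- by `f`, and the kernel contains the previous truncation.
    let π : PlaneRing →ₗ[ℂ] PlaneRing := homogeneousComponent (s + d)
    have h₂ : mulMap₃ f (homogeneousSubmodule (Fin 3) ℂ s) ≤ K.map π := by
      rw [hK, mulMap₃, mulMap₃, Submodule.map_sup, Submodule.map_sup]
      exact sup_le_sup (sup_le_sup (mulMap_homogeneous_le_map (hf 0) (ha 0) s)
        (mulMap_homogeneous_le_map (hf 1) (ha 1) s)) (mulMap_homogeneous_le_map (hf 2) (ha 2) s)
    have h₃ : (mulMap₃ (f + a) (degLT s)) ≤ (LinearMap.ker (π.domRestrict K)).map K.subtype := by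
      intro g hg
      refine ⟨⟨g, mulMap₃_mono _ (degLT_mono s.le_succ) hg⟩, ?_, rfl⟩
      exact mem_degLT_iff.1 (mulMap₃_add_le_degLT hf ha s hg) _ le_rfl
    have h₄ := LinearMap.finrank_range_add_finrank_ker (π.domRestrict K)
    have h₅ : LinearMap.range (π.domRestrict K) = K.map π := by
      rw [LinearMap.domRestrict, LinearMap.range_comp, Submodule.range_subtype]
    have h₆ := Submodule.finrank_mono h₃
    rw [Submodule.finrank_map_subtype_eq] at h₆
    have h₇ := Submodule.finrank_mono h₂
    rw [h₅] at h₄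
    omega

end FilteredDimension

/-! ### Affine Bézout bound and fixed points -/

section PointCount

open scoped LinearAlgebra.Projectivization

/-- Evaluation of polynomials at a family of points, as a linear map. -/
noncomputable def evalAt {ι : Type*} (x : ι → Fin 3 → ℂ) : PlaneRing →ₗ[ℂ] (ι → ℂ) :=
  LinearMap.pi fun i => (aeval (x i)).toLinearMap

theorem evalAt_apply {ι : Type*} (x : ι → Fin 3 → ℂ) (f : PlaneRing) (i : ι) :
    evalAt x f i = eval (x i) f := by
  simp [evalAt, aeval_eq_eval]

theorem map_evalAt_eq_top {ι : Type*} [Finite ι] (x : ι → Fin 3 → ℂ)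
    (V : Submodule ℂ PlaneRing)
    (h : ∀ i, ∃ g ∈ V, eval (x i) g ≠ 0 ∧ ∀ j ≠ i, eval (x j) g = 0) :
    V.map (evalAt x) = ⊤ := by
  classical
  cases nonempty_fintype ι
  rw [eq_top_iff]
  intro c _
  rw [← Finset.univ_sum_single c]
  refine Submodule.sum_mem _ fun i _ => ?_
  obtain ⟨g, hgV, hg, hg'⟩ := h i
  refine ⟨(c i / eval (x i) g) • g, V.smul_mem _ hgV, ?_⟩
  ext j
  rw [map_smul, Pi.smul_apply, evalAt_apply, smul_eq_mul]
  by_cases hj : j = i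
  · subst hj
    rw [Pi.single_eq_same, div_mul_cancel₀ _ hg]
  · rw [hg' j hj, mul_zero, Pi.single_eq_of_ne hj]

theorem exists_eval_ne_zero_of_injective {ι : Type*} [Fintype ι] {x : ι → Fin 3 → ℂ}
    (hx : Function.Injective x) (i : ι) :
    ∃ g : PlaneRing, eval (x i) g ≠ 0 ∧ ∀ j ≠ i, eval (x j) g = 0 := by
  classical
  have : ∀ j, ∃ k, j ≠ i → x i k ≠ x j k := by
    intro j
    by_cases hj : j = i
    · exact ⟨0, fun h => absurd hj h⟩
    · obtain ⟨k, hk⟩ := Function.ne_iff.1 (hx.ne (Ne.symm hj))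
      exact ⟨k, fun _ => hk⟩
  choose k hk using this
  refine ⟨∏ j ∈ Finset.univ.erase i, (X (k j) - C (x j (k j))), ?_, fun j hj => ?_⟩
  · rw [map_prod, Finset.prod_ne_zero_iff]
    intro j hj
    simpa [sub_eq_zero] using hk j (Finset.ne_of_mem_erase hj)
  · rw [map_prod]
    exact Finset.prod_eq_zero (Finset.mem_erase.2 ⟨hj, Finset.mem_univ j⟩) (by simp)

theorem exists_mem_degLT (f : PlaneRing) : ∃ s, f ∈ degLT s :=
  ⟨f.totalDegree + 1, mem_degLT_iff.2 fun _ hi => homogeneousComponent_eq_zero _ _ (by omega)⟩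

theorem six_mul_choose_three (n : ℕ) : (((n + 2).choose 3 : ℕ) : ℤ) * 6 = (n + 2) * (n + 1) * n := by
  have h := Nat.descFactorial_eq_factorial_mul_choose (n + 2) 3
  simp only [Nat.descFactorial_succ, Nat.descFactorial_zero, Nat.factorial] at h
  have h' : (n + 2 - 2) * ((n + 2 - 1) * ((n + 2 - 0) * 1)) = n * ((n + 1) * (n + 2)) := by
    rw [Nat.sub_zero, Nat.add_sub_cancel, mul_one, show n + 2 - 1 = n + 1 by omega]
  rw [h'] at h
  zify at h
  linarith

/-- The affine Bézout bound: if `f 0, f 1, f 2` is a regular sequence of forms of degree `d`, then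
perturbing it by polynomials of degree less than `d` gives at most `d ^ 3` common zeros. -/
theorem card_commonZeros_le {f a : Fin 3 → PlaneRing} {d : ℕ} (hf : ∀ i, (f i).IsHomogeneous d)
    (hreg : IsRegularTriple f) (ha : ∀ i, a i ∈ degLT d) {ι : Type*} [Fintype ι]
    {x : ι → Fin 3 → ℂ} (hx : Function.Injective x) (h0 : ∀ i k, eval (x i) (f k + a k) = 0) :
    Fintype.card ι ≤ d ^ 3 := by
  choose g hg hg' using exists_eval_ne_zero_of_injective hx
  choose n hn using fun i => exists_mem_degLT (g i)
  set k := Finset.univ.sup n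
  -- The summand `2 * d` makes the subtractions `s - d` and `s - d - d` genuine; the summand `k`
  -- puts all separating polynomials in `degLT (s + d)`, so evaluation there is onto.
  set s := k + 2 * d with hs
  have htop : (degLT (s + d)).map (evalAt x) = ⊤ :=
    map_evalAt_eq_top x _ fun i => ⟨g i, degLT_mono
      ((Finset.le_sup (Finset.mem_univ i)).trans (by omega)) (hn i), hg i, hg' i⟩
  set V := degLT (s + d) with hV
  have h₁ := LinearMap.finrank_range_add_finrank_ker ((evalAt x).domRestrict V)
  rw [LinearMap.domRestrict, LinearMap.range_comp, Submodule.range_subtype, htop, finrank_top,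
    Module.finrank_fintype_fun_eq_card] at h₁
  have hle : mulMap₃ (f + a) (degLT s) ≤
      (LinearMap.ker (evalAt x ∘ₗ V.subtype)).map V.subtype := by
    intro u hu
    refine ⟨⟨u, mulMap₃_add_le_degLT hf ha s hu⟩, ?_, rfl⟩
    have hz : ∀ k, mulMap ((f + a) k) (degLT s) ≤ LinearMap.ker (evalAt x) := by
      intro k w hw
      obtain ⟨v, -, rfl⟩ := mem_mulMap.1 hw
      rw [LinearMap.mem_ker]
      ext i
      rw [evalAt_apply, map_mul, Pi.add_apply, h0, zero_mul, Pi.zero_apply]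
    exact sup_le (sup_le (hz 0) (hz 1)) (hz 2) hu
  have h₂ := Submodule.finrank_mono hle
  rw [Submodule.finrank_map_subtype_eq] at h₂
  have h₃ := finrank_mulMap₃_le_finrank_mulMap₃_add hf ha s
  have h₄ := finrank_mulMap₃_ge hf hreg s
  rw [finrank_degLT, finrank_degLT, finrank_degLT] at h₄
  rw [hV, finrank_degLT] at h₁
  -- The number of points is at most the third difference, with step d, of the cubic (n + 2)(n + 1)n
  -- / 6, which is d³.
  have e₀ := six_mul_choose_three (s + d)
  have e₁ := six_mul_choose_three s
  have e₂ := six_mul_choose_three (s - d)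
  have e₃ := six_mul_choose_three (s - d - d)
  have c₂ : ((s - d : ℕ) : ℤ) = k + d := by omega
  have c₃ : ((s - d - d : ℕ) : ℤ) = k := by omega
  have c₁ : (s : ℤ) = k + 2 * d := by omega
  rw [c₃] at e₃
  rw [c₂] at e₂
  rw [c₁] at e₁
  push_cast at e₀
  rw [c₁] at e₀
  zify at *
  linarith

theorem eval_smul_of_isHomogeneous {f : PlaneRing} {d : ℕ} (hf : f.IsHomogeneous d) (c : ℂ)
    (x : Fin 3 → ℂ) : eval (c • x) f = c ^ d * eval x f := by
  rw [eval_eq', eval_eq', Finset.mul_sum]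
  refine Finset.sum_congr rfl fun m hm => ?_
  have hdeg : ∑ i, m i = d := by
    rw [← Finsupp.degree_eq_sum]
    by_contra h
    exact mem_support_iff.1 hm (hf.coeff_eq_zero h)
  simp only [Pi.smul_apply, smul_eq_mul, mul_pow]
  rw [Finset.prod_mul_distrib, Finset.prod_pow_eq_pow_sum, hdeg]
  ring

/-- A nonzero common zero p would bring with it the d³ + 1 distinct zeros 0, p, 2p, ..., d³p,
against the Bézout bound with no perturbation. -/
theorem eq_zero_of_forall_eval_eq_zero {f : Fin 3 → PlaneRing} {d : ℕ}
    (hf : ∀ i, (f i).IsHomogeneous d) (hreg : IsRegularTriple f) {p : Fin 3 → ℂ}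
    (hp : ∀ i, eval p (f i) = 0) : p = 0 := by
  by_contra hp0
  have hinj : Function.Injective fun k : Fin (d ^ 3 + 1) => ((k : ℕ) : ℂ) • p := by
    intro k l hkl
    exact Fin.ext (Nat.cast_injective (smul_left_injective ℂ hp0 hkl))
  have := card_commonZeros_le (a := 0) hf hreg (fun _ => zero_mem _) hinj fun k i => by
    simp [eval_smul_of_isHomogeneous (hf i), hp i]
  rw [Fintype.card_fin] at this
  omega

theorem X_mem_degLT {d : ℕ} (hd : 2 ≤ d) (i : Fin 3) : (X i : PlaneRing) ∈ degLT d :=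
  homogeneousSubmodule_le_degLT (t := 1) (by omega) (isHomogeneous_X ℂ i)

/-- The endomorphism of the projective plane given by a regular sequence of forms of degree
`d ≥ 2` has at most `d ^ 2 + d + 1` fixed points. -/
theorem card_fixedPoints_le {f : Fin 3 → PlaneRing} {d : ℕ} (hd : 2 ≤ d)
    (hf : ∀ i, (f i).IsHomogeneous d) (hreg : IsRegularTriple f)
    (S : Finset (ℙ ℂ (Fin 3 → ℂ)))
    (hS : ∀ P ∈ S, ∃ c : ℂ, ∀ i, eval P.rep (f i) = c * P.rep i) :
    S.card ≤ d ^ 2 + d + 1 := by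
  obtain ⟨k, rfl⟩ : ∃ k, d = k + 1 := ⟨d - 1, by omega⟩
  have hk : k ≠ 0 := by omega
  have hμ : ∀ P : S, ∃ μ : ℂ, μ ≠ 0 ∧ ∀ i, μ ^ k * eval P.1.rep (f i) = P.1.rep i := by
    intro P
    obtain ⟨c, hc⟩ := hS P.1 P.2
    have hc0 : c ≠ 0 := by
      rintro rfl
      exact P.1.rep_nonzero (eq_zero_of_forall_eval_eq_zero hf hreg
        fun i => by rw [hc, zero_mul])
    -- With k = d - 1 and f(p) = cp, this scaling gives f(μp) = μ^d c p = μp; multiplying μ by a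
    -- k-th root of unity preserves the equation.
    obtain ⟨μ, hμ⟩ := IsAlgClosed.exists_pow_nat_eq c⁻¹ (Nat.pos_of_ne_zero hk)
    refine ⟨μ, ?_, fun i => ?_⟩
    · rintro rfl
      rw [zero_pow hk] at hμ
      exact inv_ne_zero hc0 hμ.symm
    · rw [hc, hμ, inv_mul_cancel_left₀ hc0]
  choose μ hμ0 hμ using hμ
  have : NeZero k := ⟨hk⟩
  have : Fintype (rootsOfUnity k ℂ) := Fintype.ofFinite _
  -- `none` stands for the origin, the extra solution that turns d³ into d³ - 1 = (d - 1)(d² + d +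
  -- 1).
  let x : Option (S × rootsOfUnity k ℂ) → Fin 3 → ℂ := fun o =>
    o.elim 0 fun q => (((q.2 : ℂˣ) : ℂ) * μ q.1) • q.1.1.rep
  have hne : ∀ q : S × rootsOfUnity k ℂ, (((q.2 : ℂˣ) : ℂ) * μ q.1) ≠ 0 := fun q =>
    mul_ne_zero (Units.ne_zero _) (hμ0 _)
  have hinj : Function.Injective x := by
    intro o o' h
    match o, o' with
    | none, none => rfl
    | none, some q =>
      exact absurd h.symm (smul_ne_zero (hne q) q.1.1.rep_nonzero)
    | some q, none => exact absurd h (smul_ne_zero (hne q) q.1.1.rep_nonzero)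
    | some (P, ζ), some (P', ζ') =>
      simp only [x, Option.elim_some] at h
      have hPP : P = P' := by
        apply Subtype.ext
        rw [← P.1.mk_rep, ← P'.1.mk_rep, Projectivization.mk_eq_mk_iff']
        refine ⟨(((ζ : ℂˣ) : ℂ) * μ P)⁻¹ * (((ζ' : ℂˣ) : ℂ) * μ P'), ?_⟩
        rw [mul_smul, ← h, inv_smul_smul₀ (hne (P, ζ))]
      subst hPP
      have := mul_right_cancel₀ (hμ0 P) (smul_left_injective ℂ P.1.rep_nonzero h)
      rw [Subtype.ext (Units.ext this)]
  have hzero : ∀ o i, eval (x o) (f i + (fun i => -X i) i) = 0 := by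
    intro o i
    match o with
    | none =>
      have := eval_smul_of_isHomogeneous (hf i) 0 0
      rw [zero_smul, zero_pow k.succ_ne_zero, zero_mul] at this
      simp only [x, Option.elim_none, map_add, map_neg, eval_X, this, Pi.zero_apply, neg_zero,
        add_zero]
    | some (P, ζ) =>
      have hζ : (((ζ : ℂˣ) : ℂ)) ^ k = 1 := by
        have := ζ.2
        rw [mem_rootsOfUnity'] at this
        exact this
      simp only [x, Option.elim_some, map_add, map_neg, eval_X, Pi.smul_apply, smul_eq_mul]
      rw [eval_smul_of_isHomogeneous (hf i), mul_pow, pow_succ, pow_succ, hζ]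
      linear_combination (((ζ : ℂˣ) : ℂ) * μ P) * hμ P i
  have := card_commonZeros_le hf hreg (a := fun i => -X i)
    (fun i => neg_mem (X_mem_degLT hd i)) hinj hzero
  rw [Fintype.card_option, Fintype.card_prod, Fintype.card_coe, ← Nat.card_eq_fintype_card,
    Complex.card_rootsOfUnity] at this
  have h' : S.card * k ≤ ((k + 1) ^ 2 + (k + 1) + 1) * k := by linarith
  exact Nat.le_of_mul_le_mul_right h' (Nat.pos_of_ne_zero hk)

end PointCount

/-! ### Interpolation and the degree of a finite set of points -/

section Interpolation

open scoped LinearAlgebra.Projectivization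

theorem exists_minor_ne_zero {p q : Fin 3 → ℂ} (hq : q ≠ 0) (h : ∀ c : ℂ, p ≠ c • q) :
    ∃ k l, p k * q l - p l * q k ≠ 0 := by
  by_contra! hall
  obtain ⟨l, hl⟩ := Function.ne_iff.1 hq
  refine h (p l / q l) (funext fun k => ?_)
  have := hall k l
  rw [Pi.zero_apply] at hl
  rw [Pi.smul_apply, smul_eq_mul]
  field_simp
  linear_combination this

theorem exists_linearForm_separating {P Q : ℙ ℂ (Fin 3 → ℂ)} (h : P ≠ Q) :
    ∃ ℓ : PlaneRing, ℓ.IsHomogeneous 1 ∧ eval P.rep ℓ ≠ 0 ∧ eval Q.rep ℓ = 0 := by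
  obtain ⟨k, l, hkl⟩ := exists_minor_ne_zero (p := P.rep) Q.rep_nonzero fun c hc => h <| by
    rw [← P.mk_rep, ← Q.mk_rep, Projectivization.mk_eq_mk_iff']
    exact ⟨c, hc.symm⟩
  refine ⟨C (Q.rep l) * X k - C (Q.rep k) * X l,
    (isHomogeneous_C_mul_X _ _).sub (isHomogeneous_C_mul_X _ _), ?_, ?_⟩
  · simpa [mul_comm] using hkl
  · simp [mul_comm]

/-- Forms of every degree `t ≥ |S|` separate the points of a finite set `S` in the plane. -/
theorem exists_form_separating (S : Finset (ℙ ℂ (Fin 3 → ℂ))) {t : ℕ} (ht : S.card ≤ t) (P : S) :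
    ∃ g ∈ homogeneousSubmodule (Fin 3) ℂ t, eval P.1.rep g ≠ 0 ∧
      ∀ Q : S, Q ≠ P → eval Q.1.rep g = 0 := by
  classical
  have : ∀ Q : S, ∃ ℓ : PlaneRing, ℓ.IsHomogeneous 1 ∧ eval P.1.rep ℓ ≠ 0 ∧
      (Q ≠ P → eval Q.1.rep ℓ = 0) := by
    intro Q
    by_cases hQ : Q = P
    · obtain ⟨k, hk⟩ := Function.ne_iff.1 P.1.rep_nonzero
      exact ⟨X k, isHomogeneous_X ℂ k, by simpa using hk, fun h => absurd hQ h⟩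
    · obtain ⟨ℓ, h₁, h₂, h₃⟩ := exists_linearForm_separating
        (P := P.1) (Q := Q.1) fun h => hQ (Subtype.ext h.symm)
      exact ⟨ℓ, h₁, h₂, fun _ => h₃⟩
  choose ℓ h₁ h₂ h₃ using this
  -- The power of `ℓ P`, a coordinate nonvanishing at `P`, pads the product to degree t.
  refine ⟨(∏ Q, ℓ Q) * ℓ P ^ (t - S.card), ?_, ?_, fun Q hQ => ?_⟩
  · have hprod := IsHomogeneous.prod Finset.univ ℓ (fun _ => 1) fun Q _ => h₁ Q
    have := hprod.mul ((h₁ P).pow (t - S.card))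
    rw [Finset.sum_const, Finset.card_univ, Fintype.card_coe, smul_eq_mul, mul_one, one_mul,
      Nat.add_sub_cancel' ht] at this
    exact this
  · rw [map_mul, map_prod, map_pow]
    exact mul_ne_zero (Finset.prod_ne_zero_iff.2 fun Q _ => h₂ Q) (pow_ne_zero _ (h₂ P))
  · rw [map_mul, map_prod, Finset.prod_eq_zero (Finset.mem_univ Q) (h₃ Q hQ), zero_mul]

theorem finrank_map_eq_of_forall_eq_zero_iff {K V W W' : Type*} [Field K] [AddCommGroup V]
    [Module K V] [AddCommGroup W] [Module K W] [AddCommGroup W'] [Module K W']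
    (U : Submodule K V) [FiniteDimensional K U] (g : V →ₗ[K] W) (h : V →ₗ[K] W')
    (hgh : ∀ v ∈ U, g v = 0 ↔ h v = 0) :
    Module.finrank K (U.map g) = Module.finrank K (U.map h) := by
  have hker : LinearMap.ker (g ∘ₗ U.subtype) = LinearMap.ker (h ∘ₗ U.subtype) := by
    ext v
    exact hgh v.1 v.2
  have h₁ := LinearMap.finrank_range_add_finrank_ker (g ∘ₗ U.subtype)
  have h₂ := LinearMap.finrank_range_add_finrank_ker (h ∘ₗ U.subtype)
  rw [LinearMap.range_comp, Submodule.range_subtype] at h₁ h₂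
  rw [hker] at h₁
  omega

/-- If the forms of positive degree in `I` are those vanishing on a finite set of points in the
plane, then the degree of `I` is the number of points. -/
theorem hasDegree_card {I : Ideal PlaneRing} (S : Finset (ℙ ℂ (Fin 3 → ℂ)))
    (hI : ∀ t ≠ 0, ∀ f : PlaneRing, f.IsHomogeneous t →
      (f ∈ I ↔ ∀ P ∈ S, eval P.rep f = 0)) :
    HasDegree I (S.card : ℚ) := by
  refine ⟨Polynomial.C (S.card : ℚ), ?_, by
    rw [Polynomial.natDegree_C, Polynomial.leadingCoeff_C, Nat.factorial_zero, Nat.cast_one,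
      one_mul]⟩
  -- The `+ 1` keeps t positive even when `S` is empty, so that `hI` applies.
  filter_upwards [eventually_ge_atTop (S.card + 1)] with t ht
  rw [Polynomial.eval_C, Nat.cast_inj]
  let x : S → Fin 3 → ℂ := fun P => P.1.rep
  have htop := map_evalAt_eq_top x (homogeneousSubmodule (Fin 3) ℂ t)
    (exists_form_separating S (by omega))
  -- On forms of degree t, reduction modulo `I` and evaluation on `S` have the same kernel, hence
  -- the same rank.
  rw [hilbertFunction, finrank_map_eq_of_forall_eq_zero_iff (homogeneousSubmodule (Fin 3) ℂ t) _
    (evalAt x), htop, finrank_top,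
    Module.finrank_fintype_fun_eq_card, Fintype.card_coe]
  intro f hf
  rw [AlgHom.toLinearMap_apply, Ideal.Quotient.mkₐ_eq_mk, Ideal.Quotient.eq_zero_iff_mem,
    hI t (by omega) f hf, funext_iff]
  simp only [evalAt_apply, Pi.zero_apply, Subtype.forall, x]

end Interpolation

/-! ### Regular sequences in divisibility form -/

theorem isRegularTriple_of_isRegular {f : Fin 3 → PlaneRing}
    (h : RingTheory.Sequence.IsRegular PlaneRing [f 0, f 1, f 2]) :
    IsRegularTriple f := by
  have key : ∀ (I : Ideal PlaneRing) (r w : PlaneRing),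
      IsSMulRegular (PlaneRing ⧸ (I • ⊤ : Submodule PlaneRing PlaneRing)) r →
      r * w ∈ I → w ∈ I := by
    intro I r w hr hw
    have hI : (I • ⊤ : Submodule PlaneRing PlaneRing) = I := by simp
    rw [hI] at hr
    rw [isSMulRegular_iff_right_eq_zero_of_smul] at hr
    rw [← Submodule.Quotient.mk_eq_zero I]
    apply hr
    rw [← Submodule.Quotient.mk_smul, smul_eq_mul]
    exact (Submodule.Quotient.mk_eq_zero I).2 hw
  have r0 := h.regular_mod_prev 0 (by simp)
  have r1 := h.regular_mod_prev 1 (by simp)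
  have r2 := h.regular_mod_prev 2 (by simp)
  simp only [List.take_zero, List.take_succ_cons, List.getElem_cons_zero,
    List.getElem_cons_succ] at r0 r1 r2
  have e1 : Ideal.ofList [f 0] = Ideal.span {f 0} := by simp
  have e2 : Ideal.ofList [f 0, f 1] = Ideal.span {f 0, f 1} := by
    simp [Ideal.span_insert]
  refine ⟨?_, fun v hv => ?_, ?_⟩
  · have htop : (1 : PlaneRing) ∉ Ideal.ofList [f 0, f 1, f 2] := by
      intro h1
      apply h.top_ne_smul
      rw [(Ideal.eq_top_iff_one _).2 h1]
      simp
    -- If 0 were regular modulo the preceding entries, 1 would lie in their ideal, hence in the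
    -- proper ideal of all three.
    have hmem : ∀ (l : List PlaneRing) (r : PlaneRing),
        (∀ x ∈ l, x ∈ [f 0, f 1, f 2]) →
        IsSMulRegular (PlaneRing ⧸ (Ideal.ofList l • ⊤ : Submodule PlaneRing PlaneRing)) r →
        r ≠ 0 := by
      rintro l r hl hr rfl
      refine htop (Ideal.span_mono hl (key _ _ 1 hr ?_))
      rw [zero_mul]
      exact zero_mem _
    intro i
    fin_cases i
    exacts [hmem _ _ (by simp) r0, hmem _ _ (by simp) r1, hmem _ _ (by simp) r2]
  · have := key _ _ v r1 (by rw [e1]; exact Ideal.mem_span_singleton.2 hv)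
    rwa [e1, Ideal.mem_span_singleton] at this
  · rintro w ⟨u, v, huv⟩
    have := key _ _ w r2 (by
      rw [e2, huv]
      exact Ideal.mem_span_pair.2 ⟨u, v, by ring⟩)
    rw [e2] at this
    obtain ⟨a, b, hab⟩ := Ideal.mem_span_pair.1 this
    exact ⟨a, b, by rw [← hab]; ring⟩

/-! ### Singular points of a line arrangement -/

namespace LineArrangement

open scoped LinearAlgebra.Projectivization

variable (𝒜 : LineArrangement)

theorem isHomogeneous_form (i : Fin 𝒜.n) : (𝒜.form i).IsHomogeneous 1 :=
  IsHomogeneous.sum _ _ _ fun _ _ => isHomogeneous_C_mul_X _ _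

theorem coeff_single_form (i : Fin 𝒜.n) (j : Fin 3) :
    MvPolynomial.coeff (Finsupp.single j 1) (𝒜.form i) = 𝒜.coeff i j := by
  classical
  simp [form, coeff_sum, coeff_C_mul, coeff_X, Finsupp.single_left_inj]

theorem form_ne_zero (i : Fin 𝒜.n) : 𝒜.form i ≠ 0 := by
  intro h
  refine 𝒜.coeff_ne_zero i (funext fun j => ?_)
  rw [← coeff_single_form, h]
  simp

theorem prime_form (i : Fin 𝒜.n) : Prime (𝒜.form i) := by
  refine (irreducible_of_totalDegree_eq_one
    ((𝒜.isHomogeneous_form i).totalDegree (𝒜.form_ne_zero i)) fun x hx => ?_).prime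
  obtain ⟨j, hj⟩ := Function.ne_iff.1 (𝒜.coeff_ne_zero i)
  refine isUnit_iff_ne_zero.2 fun h0 => hj ?_
  have := hx (Finsupp.single j 1)
  rwa [coeff_single_form, h0, zero_dvd_iff] at this

theorem not_form_dvd_form {i k : Fin 𝒜.n} (h : i ≠ k) : ¬ 𝒜.form i ∣ 𝒜.form k := by
  rintro ⟨q, hq⟩
  have hq0 : q ≠ 0 := by
    rintro rfl
    exact 𝒜.form_ne_zero k (by rw [hq, mul_zero])
  have hdeg := congrArg totalDegree hq
  rw [totalDegree_mul_of_isDomain (𝒜.form_ne_zero i) hq0,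
    (𝒜.isHomogeneous_form i).totalDegree (𝒜.form_ne_zero i),
    (𝒜.isHomogeneous_form k).totalDegree (𝒜.form_ne_zero k)] at hdeg
  obtain ⟨c, rfl⟩ : ∃ c, q = C c := ⟨_, totalDegree_eq_zero_iff_eq_C.1 (by omega)⟩
  have hc : c • 𝒜.coeff i = 𝒜.coeff k := by
    ext j
    rw [← coeff_single_form, hq, mul_comm, coeff_C_mul, coeff_single_form]
    rfl
  have := (LinearIndependent.pair_iff.1 (𝒜.distinct i k h)) c (-1) (by rw [hc]; simp)
  simp at this

theorem form_mul_prod_erase (i : Fin 𝒜.n) :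
    𝒜.form i * ∏ k ∈ Finset.univ.erase i, 𝒜.form k = 𝒜.definingPoly :=
  Finset.mul_prod_erase _ _ (Finset.mem_univ i)

/-- By Leibniz, L divides θ(L) times the product of the other forms; L is prime and, the lines being
distinct, divides none of those. -/
theorem form_dvd_derivation_form {θ : Derivation ℂ PlaneRing PlaneRing}
    (hθ : θ 𝒜.definingPoly = 0) (i : Fin 𝒜.n) : 𝒜.form i ∣ θ (𝒜.form i) := by
  rw [← 𝒜.form_mul_prod_erase i, Derivation.leibniz, smul_eq_mul, smul_eq_mul] at hθ
  have hdvd : 𝒜.form i ∣ (∏ k ∈ Finset.univ.erase i, 𝒜.form k) * θ (𝒜.form i) :=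
    ⟨-θ (∏ k ∈ Finset.univ.erase i, 𝒜.form k), by linear_combination hθ⟩
  refine ((𝒜.prime_form i).dvd_or_dvd hdvd).resolve_left fun h => ?_
  obtain ⟨k, hk, hik⟩ := ((𝒜.prime_form i).dvd_finsetProd_iff _).1 h
  exact 𝒜.not_form_dvd_form (Finset.ne_of_mem_erase hk).symm hik

theorem eval_form (i : Fin 𝒜.n) (p : Fin 3 → ℂ) :
    eval p (𝒜.form i) = 𝒜.coeff i ⬝ᵥ p := by
  simp [form, dotProduct]

theorem eval_derivation_form (θ : Derivation ℂ PlaneRing PlaneRing) (i : Fin 𝒜.n)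
    (p : Fin 3 → ℂ) :
    eval p (θ (𝒜.form i)) = 𝒜.coeff i ⬝ᵥ fun j => eval p (θ (X j)) := by
  simp [form, dotProduct, Derivation.leibniz]

/-- Two distinct lines meet in one point: the 2 × 3 matrix has rank 2, so its kernel is
one-dimensional. -/
theorem exists_smul_eq_of_dotProduct_eq_zero {a b p q : Fin 3 → ℂ}
    (h : LinearIndependent ℂ ![a, b]) (hp : p ≠ 0) (hap : a ⬝ᵥ p = 0) (hbp : b ⬝ᵥ p = 0)
    (haq : a ⬝ᵥ q = 0) (hbq : b ⬝ᵥ q = 0) : ∃ c : ℂ, c • p = q := by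
  let M : Matrix (Fin 2) (Fin 3) ℂ := Matrix.of ![a, b]
  have hrank : M.rank = 2 := by
    have := LinearIndependent.rank_matrix (M := M) h
    simpa using this
  have hker : Module.finrank ℂ (LinearMap.ker M.mulVecLin) = 1 := by
    have := LinearMap.finrank_range_add_finrank_ker M.mulVecLin
    rw [Module.finrank_fin_fun] at this
    rw [Matrix.rank] at hrank
    omega
  have hmem : ∀ v : Fin 3 → ℂ, a ⬝ᵥ v = 0 → b ⬝ᵥ v = 0 → v ∈ LinearMap.ker M.mulVecLin := by
    intro v hav hbv
    rw [LinearMap.mem_ker]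
    ext i
    fin_cases i
    exacts [hav, hbv]
  obtain ⟨c, hc⟩ := exists_smul_eq_of_finrank_eq_one hker
    (x := ⟨p, hmem p hap hbp⟩) (fun h0 => hp (congrArg Subtype.val h0)) ⟨q, hmem q haq hbq⟩
  exact ⟨c, congrArg Subtype.val hc⟩

theorem n_ne_zero : 𝒜.n ≠ 0 := by
  intro h
  have : IsEmpty (Fin 𝒜.n) := by
    rw [h]
    infer_instance
  have h' := 𝒜.essential
  rw [Set.range_eq_empty, Submodule.span_empty] at h'
  exact bot_ne_top h'

theorem isHomogeneous_definingPoly : 𝒜.definingPoly.IsHomogeneous 𝒜.n := by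
  have := IsHomogeneous.prod Finset.univ 𝒜.form (fun _ => 1) fun i _ => 𝒜.isHomogeneous_form i
  simpa [definingPoly] using this

theorem pderiv_form (i : Fin 𝒜.n) (j : Fin 3) : pderiv j (𝒜.form i) = C (𝒜.coeff i j) := by
  classical
  simp [form, Derivation.leibniz, Pi.single_apply]

/-- At a zero of all partial derivatives of the defining polynomial, two of the lines meet. -/
theorem exists_two_lines_of_singular {p : Fin 3 → ℂ}
    (hp : ∀ j, eval p (pderiv j 𝒜.definingPoly) = 0) :
    ∃ i k, i ≠ k ∧ eval p (𝒜.form i) = 0 ∧ eval p (𝒜.form k) = 0 := by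
  -- Euler's relation n Q = ∑ x_j Q_j, with n ≠ 0.
  have hQ : eval p 𝒜.definingPoly = 0 := by
    have := congrArg (eval p) 𝒜.isHomogeneous_definingPoly.sum_X_mul_pderiv
    simp only [map_sum, map_mul, hp, mul_zero, Finset.sum_const_zero, map_nsmul] at this
    exact (smul_eq_zero.1 this.symm).resolve_left 𝒜.n_ne_zero
  obtain ⟨i, -, hi⟩ := by
    rw [definingPoly, map_prod] at hQ
    exact Finset.prod_eq_zero_iff.1 hQ
  -- At p only the term differentiating the i-th form survives in Q_j; choosing j with nonzero
  -- coefficient makes the product of the other forms vanish.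
  obtain ⟨j, hj⟩ := Function.ne_iff.1 (𝒜.coeff_ne_zero i)
  have h := hp j
  rw [← 𝒜.form_mul_prod_erase i, pderiv_mul, pderiv_form, map_add, map_mul, map_mul, hi, zero_mul,
    add_zero, eval_C] at h
  have h' := (mul_eq_zero.1 h).resolve_left hj
  rw [map_prod] at h'
  obtain ⟨k, hk, hk'⟩ := Finset.prod_eq_zero_iff.1 h'
  exact ⟨i, k, (Finset.ne_of_mem_erase hk).symm, hi, hk'⟩

/-- A special logarithmic derivation fixes the singular points of the arrangement. -/
theorem exists_eval_derivation_eq_mul {θ : Derivation ℂ PlaneRing PlaneRing}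
    (hθ : θ 𝒜.definingPoly = 0) {p : Fin 3 → ℂ} (hp0 : p ≠ 0)
    (hp : ∀ j, eval p (pderiv j 𝒜.definingPoly) = 0) :
    ∃ c : ℂ, ∀ j, eval p (θ (X j)) = c * p j := by
  obtain ⟨i, k, hik, hi, hk⟩ := 𝒜.exists_two_lines_of_singular hp
  have key : ∀ l, eval p (𝒜.form l) = 0 → 𝒜.coeff l ⬝ᵥ (fun j => eval p (θ (X j))) = 0 := by
    intro l hl
    obtain ⟨g, hg⟩ := 𝒜.form_dvd_derivation_form hθ l
    rw [← eval_derivation_form, hg, map_mul, hl, zero_mul]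
  obtain ⟨c, hc⟩ := exists_smul_eq_of_dotProduct_eq_zero (𝒜.distinct i k hik) hp0
    (by rw [← eval_form, hi]) (by rw [← eval_form, hk]) (key i hi) (key k hk)
  exact ⟨c, fun j => (congrFun hc j).symm⟩

/-- The singular points of the union of the lines of an arrangement. -/
def singularPoints : Set (ℙ ℂ (Fin 3 → ℂ)) :=
  {P | ∀ j, eval P.rep (pderiv j 𝒜.definingPoly) = 0}

theorem mem_radical_jacobianIdeal_iff {t : ℕ} (ht : t ≠ 0) {f : PlaneRing}
    (hf : f.IsHomogeneous t) :
    f ∈ (jacobianIdeal 𝒜.definingPoly).radical ↔ ∀ P ∈ 𝒜.singularPoints, eval P.rep f = 0 := by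
  have hzero : ∀ x : Fin 3 → ℂ, x ∈ zeroLocus ℂ (jacobianIdeal 𝒜.definingPoly) ↔
      ∀ j, eval x (pderiv j 𝒜.definingPoly) = 0 := by
    intro x
    rw [jacobianIdeal, zeroLocus_span]
    simp [aeval_eq_eval]
  rw [← vanishingIdeal_zeroLocus_eq_radical (K := ℂ), mem_vanishingIdeal_iff]
  simp only [aeval_eq_eval]
  constructor
  · exact fun h P hP => h P.rep ((hzero _).2 hP)
  · intro h x hx
    -- The affine zero locus may contain the origin, which is no projective point; forms of positive
    -- degree vanish there anyway.
    by_cases hx0 : x = 0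
    · have := eval_smul_of_isHomogeneous hf 0 0
      rw [zero_smul, zero_pow ht, zero_mul] at this
      rw [hx0, this]
    · obtain ⟨c, hc⟩ := Projectivization.exists_smul_eq_mk_rep ℂ x hx0
      have hc' : (c : ℂ) • x = (Projectivization.mk ℂ x hx0).rep := hc
      have hmem : Projectivization.mk ℂ x hx0 ∈ 𝒜.singularPoints := by
        intro j
        rw [← hc', eval_smul_of_isHomogeneous 𝒜.isHomogeneous_definingPoly.pderiv,
          (hzero x).1 hx j, mul_zero]
      have := h _ hmem
      rw [← hc', eval_smul_of_isHomogeneous hf] at this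
      exact (mul_eq_zero.1 this).resolve_left (pow_ne_zero _ c.ne_zero)

end LineArrangement

/-! ### The degree bound -/

theorem proposition3p1 (𝒜 : LineArrangement) (hfree : IsFreeCurve 𝒜.definingPoly)
    (d : ℕ) (hd : 2 ≤ d) (θ : Derivation ℂ PlaneRing PlaneRing)
    (hθ : IsRegularSpecialLogDerivation 𝒜.definingPoly d θ) :
    ∃ e : ℕ, HasDegree (jacobianIdeal 𝒜.definingPoly).radical (e : ℚ) ∧
      e ≤ d ^ 2 + d + 1 := by
  have hreg := isRegularTriple_of_isRegular (f := fun i => θ (X i)) hθ.regular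
  have hbound : ∀ S : Finset (Projectivization ℂ (Fin 3 → ℂ)), ↑S ⊆ 𝒜.singularPoints →
      S.card ≤ d ^ 2 + d + 1 := fun S hS =>
    card_fixedPoints_le hd hθ.homogeneous hreg S fun P hP =>
      𝒜.exists_eval_derivation_eq_mul hθ.special P.rep_nonzero (hS hP)
  -- Finiteness follows from the uniform bound on finite subsets.
  have hfin : 𝒜.singularPoints.Finite := by
    by_contra hinf
    obtain ⟨S, hS, hcard⟩ := Set.Infinite.exists_subset_card_eq hinf (d ^ 2 + d + 2)
    have := hbound S hS
    omega
  refine ⟨hfin.toFinset.card, hasDegree_card _ fun t ht f hf => ?_, hbound _ (by simp)⟩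
  rw [𝒜.mem_radical_jacobianIdeal_iff ht hf]
  simp only [Set.Finite.mem_toFinset]
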